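/- Let $N$ be an odd positive integer. Here $\zeta$ is the Riemann zeta function, and "transcendental" means transcendental over $\mathbb{Q}$. (1) For every integer $k\ge 0$ and every integer $j$ with $0\le j\le \frac{N-1}{2}$ the series below converge, and the set $$\bigcup_{k=0}^{\infty}\left\{\zeta(4k+3),\ \sum_{n=1}^{\infty}\frac{n^{-2N(2k+1)-1}}{\exp\left((2n)^N\pi\right)-1},\ \sum_{n=1}^{\infty}\frac{1}{n^{4k+3}}\operatorname{Re}\left(\frac{1}{\exp\left((2n)^{1/N}\pi e^{i\pi j/N}\right)-1}\right) : 0\le j\le \frac{N-1}{2}\right\}$$ contains infinitely many (distinct) transcendental numbers. (2) If moreover $N>1$, then for every integer $k\ge 1$ and every integer $j$ with $0\le j\le \frac{N-1}{2}$ the series below converge, and the set $$\bigcup_{k=1}^{\infty}\left\{\zeta(4k+1),\ \sum_{n=1}^{\infty}\frac{n^{-4Nk-1}}{\exp\left((2n)^N\pi\right)-1},\ \sum_{n=1}^{\infty}\frac{1}{n^{4k+1}}\operatorname{Re}\left(\frac{1}{\exp\left((2n)^{1/N}\pi e^{i\pi j/N}\right)-1}\right) : 0\le j\le \frac{N-1}{2}\right\}$$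 contains infinitely many (distinct) transcendental numbers. -/

import Mathlib

open scoped BigOperators

noncomputable section

/-- The `n`-th term `n^{-s} / (exp((2n)^N π) - 1)` of the generalized Lambert series. -/
def lambertTerm (N s n : ℕ) : ℝ :=
  (n : ℝ) ^ (-(s : ℤ)) / (Real.exp ((2 * (n : ℝ)) ^ N * Real.pi) - 1)

/-- The generalized Lambert series `∑_{n ≥ 1} n^{-s} / (exp((2n)^N π) - 1)`. -/
def lambertSeries (N s : ℕ) : ℝ :=
  ∑' n : ℕ, lambertTerm N s (n + 1)

/-- The `n`-th term `n^{-s} Re (1 / (exp((2n)^{1/N} π e^{iπj/N}) - 1))` of the rotated series. -/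
def rotatedTerm (N s j n : ℕ) : ℝ :=
  1 / (n : ℝ) ^ s *
    (1 / (Complex.exp ((((2 * (n : ℝ)) ^ (1 / (N : ℝ)) : ℝ) : ℂ) * (Real.pi : ℂ) *
      Complex.exp (Complex.I * (Real.pi : ℂ) * (j : ℂ) / (N : ℂ))) - 1)).re

/-- The rotated series `∑_{n ≥ 1} n^{-s} Re (1 / (exp((2n)^{1/N} π e^{iπj/N}) - 1))`. -/
def rotatedSeries (N s j : ℕ) : ℝ :=
  ∑' n : ℕ, rotatedTerm N s j (n + 1)

end

/-! Let N = 2p+1 and let a, b run over the positive even numbers. Compare the double series of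
a^(2p) / (a^(2Nm) (a^(2N) + b²)) with (-1)^m times that of a^(2p) / (b^(2m) (a^(2N) + b²)). By the
factorization of 1/u^m - (-1/v)^m (`inv_pow_sub_inv_neg_pow`), their difference is a finite sum of
products of even zeta sums. Summing the first over b by the coth expansion at a^N gives ζ(2Nm+1) and
the Lambert series. Summing the second over a, by partial fractions and the coth expansion at the
points b^(1/N) e^(iπj/N), gives ζ(2m+1) and the rotated series. This is `lambert_sub_rotated_eq`. By
Euler's formula, a rational combination of these four kinds of numbers is then a rational polynomial
in π of degree at least m (`exists_polynomial_lambertCombination`). As m grows, the rational span of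
the set contains polynomials in π of unbounded degree. With only finitely many transcendental
members, the span of the set over the algebraic numbers would be finite-dimensional, which
contradicts the transcendence of π (`infinite_transcendental_of_span`). Odd m gives part (1), even m
gives part (2). For N = 1 and m even the Lambert and rotated series coincide and the combination is
zero, so the argument for (2) needs N > 1. -/

/-! ### Transcendence of π, by Lindemann's method. -/

open Polynomial in
/-- If `a • x` is integral, then so is `a ^ D • g(x)` for integer polynomials `g` of degree at most `D`. -/
theorem isIntegral_pow_smul_aeval {K : Type*} [CommRing K] (a : ℤ) (x : K)
    (hx : IsIntegral ℤ (a • x)) (g : ℤ[X]) {D : ℕ} (hg : g.natDegree ≤ D) :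
    IsIntegral ℤ (a ^ D • aeval x g) := by
  rw [aeval_eq_sum_range' (Nat.lt_succ_of_le hg), Finset.smul_sum]
  refine IsIntegral.sum _ fun i hi => ?_
  have hi' : i ≤ D := Nat.lt_succ_iff.1 (Finset.mem_range.1 hi)
  have : a ^ D • g.coeff i • x ^ i = (a ^ (D - i) * g.coeff i) • (a • x) ^ i := by
    rw [_root_.smul_pow, smul_smul, smul_smul, ← pow_sub_mul_pow a hi']
    congr 1
    ring
  rw [this]
  exact (hx.pow i).smul _

/-- A Galois-invariant algebraic integer is a rational integer. -/
theorem exists_int_cast_eq_of_fixed {K : Type*} [Field K] [Algebra ℚ K] [IsGalois ℚ K] {x : K}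
    (hint : IsIntegral ℤ x) (hfix : ∀ σ : K ≃ₐ[ℚ] K, σ x = x) : ∃ z : ℤ, (z : K) = x := by
  obtain ⟨q, rfl⟩ := (InfiniteGalois.mem_range_algebraMap_iff_fixed x).2 hfix
  rw [isIntegral_algebraMap_iff (algebraMap ℚ K).injective] at hint
  obtain ⟨z, rfl⟩ := IsIntegrallyClosed.isIntegral_iff.1 hint
  exact ⟨z, by simp⟩

open Polynomial in
/-- Finitely many nonzero algebraic numbers are roots of an integer polynomial with nonzero
constant term. -/
theorem exists_int_polynomial_of_isAlgebraic {K : Type*} [Field K] [Algebra ℚ K]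
    [Algebra.IsAlgebraic ℚ K] (T : Finset K) (h0 : ∀ t ∈ T, t ≠ 0) :
    ∃ f : ℤ[X], f.eval 0 ≠ 0 ∧ ∀ t ∈ T, aeval t f = 0 := by
  have key : ∀ t : K, ∃ q : ℤ[X], t ≠ 0 → q.coeff 0 ≠ 0 ∧ aeval t q = 0 := by
    intro t
    by_cases ht : t = 0
    · exact ⟨0, fun h => absurd ht h⟩
    have halg : IsAlgebraic ℤ t :=
      (IsFractionRing.isAlgebraic_iff ℤ ℚ K).2 (Algebra.IsAlgebraic.isAlgebraic t)
    obtain ⟨q, hq⟩ := halg.exists_nonzero_coeff_and_aeval_eq_zero (mem_nonZeroDivisors_of_ne_zero ht)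
    exact ⟨q, fun _ => hq⟩
  choose q hq using key
  refine ⟨∏ t ∈ T, q t, ?_, fun t ht => ?_⟩
  · rw [eval_prod, Finset.prod_ne_zero_iff]
    intro t ht
    rw [← coeff_zero_eq_eval_zero]
    exact (hq t (h0 t ht)).1
  · rw [map_prod]
    exact Finset.prod_eq_zero ht (hq t (h0 t ht)).2

open Polynomial in
/-- A Galois-invariant sum of exponentials of nonzero algebraic numbers is not a negative integer. -/
theorem natCast_add_sum_exp_ne_zero {K : Type*} [Field K] [Algebra ℚ K] [IsGalois ℚ K]
    (ι : K →+* ℂ) (T : Multiset K) (hT0 : (0 : K) ∉ T)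
    (hinv : ∀ σ : K ≃ₐ[ℚ] K, T.map σ = T) {k : ℕ} (hk : k ≠ 0) :
    (k : ℂ) + (T.map fun t => Complex.exp (ι t)).sum ≠ 0 := by
  classical
  intro hsum
  obtain ⟨f, hf0, hfT⟩ := exists_int_polynomial_of_isAlgebraic T.toFinset
    (fun t ht h => hT0 (h ▸ Multiset.mem_toFinset.1 ht))
  have hf : f ≠ 0 := by rintro rfl; simp at hf0
  have hroot : ∀ t ∈ T, ι t ∈ f.aroots ℂ := by
    intro t ht
    rw [mem_aroots]
    refine ⟨hf, ?_⟩
    have := hfT t (Multiset.mem_toFinset.2 ht)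
    rw [show ι t = ι.toIntAlgHom t from rfl, aeval_algHom_apply, this, map_zero]
  obtain ⟨c, hc⟩ := LindemannWeierstrass.exp_polynomial_approx f hf0
  set a : ℤ := f.leadingCoeff with ha
  have ha0 : a ≠ 0 := leadingCoeff_ne_zero.2 hf
  set C : ℝ := |(a : ℝ)| ^ f.natDegree * c with hC
  have hlim := (FloorSemiring.tendsto_pow_div_factorial_atTop C).const_mul ((T.card : ℝ) * C)
  rw [mul_zero] at hlim
  have hev := (hlim.comp (Filter.tendsto_sub_atTop_nat 1)).eventually (gt_mem_nhds one_pos)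
  obtain ⟨p₀, hp₀⟩ := Filter.eventually_atTop.1 hev
  -- A prime p above |f(0)| admits the approximation of the exponentials; above k and |a| it divides
  -- neither; above p₀ the error is less than 1.
  obtain ⟨p, hple, hp⟩ := Nat.exists_infinite_primes
    (p₀ + (eval 0 f).natAbs + k + a.natAbs + 1)
  obtain ⟨n, hpn, g, hgdeg, hg⟩ := hc p (by omega) hp
  have hsmall := hp₀ p (by omega)
  set D := p * f.natDegree with hD
  have hint : IsIntegral ℤ (T.map fun t => a ^ D • aeval t g).sum := by
    refine IsIntegral.multiset_sum fun x hx => ?_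
    obtain ⟨t, ht, rfl⟩ := Multiset.mem_map.1 hx
    exact isIntegral_pow_smul_aeval a t
      (isIntegral_leadingCoeff_smul f t (hfT t (Multiset.mem_toFinset.2 ht))) g (by omega)
  have hfix : ∀ σ : K ≃ₐ[ℚ] K, σ (T.map fun t => a ^ D • aeval t g).sum =
      (T.map fun t => a ^ D • aeval t g).sum := by
    intro σ
    rw [map_multiset_sum, Multiset.map_map]
    conv_rhs => rw [← hinv σ, Multiset.map_map]
    congr 1
    refine Multiset.map_congr rfl fun t _ => ?_
    simp only [Function.comp_apply, map_zsmul]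
    congr 1
    exact (aeval_algHom_apply (σ.toAlgHom.restrictScalars ℤ) t g).symm
  obtain ⟨z, hz⟩ := exists_int_cast_eq_of_fixed hint hfix
  have hzC : (z : ℂ) = (T.map fun t => (a : ℂ) ^ D * aeval (ι t) g).sum := by
    have := congrArg ι hz
    rw [map_intCast, map_multiset_sum, Multiset.map_map] at this
    rw [this]
    congr 1
    refine Multiset.map_congr rfl fun t _ => ?_
    simp only [Function.comp_apply, zsmul_eq_mul, map_mul, Int.cast_pow, map_pow, map_intCast]
    congr 1
    exact (aeval_algHom_apply ι.toIntAlgHom t g).symm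
  -- Modulo p this integer is a^D n k, hence nonzero. The assumed relation makes it, up to sign, the
  -- sum of the scaled approximation errors, hence of absolute value below 1.
  set M : ℤ := a ^ D * n * k + p * z with hM
  have hMC : (M : ℂ) = -(T.map fun t => (a : ℂ) ^ D *
      (n • Complex.exp (ι t) - p • aeval (ι t) g)).sum := by
    have h1 : (T.map fun t => (a : ℂ) ^ D * (n • Complex.exp (ι t) - p • aeval (ι t) g)).sum =
        (a : ℂ) ^ D * n * (T.map fun t => Complex.exp (ι t)).sum - p * z := by
      rw [hzC, ← Multiset.sum_map_mul_left, ← Multiset.sum_map_mul_left, ← Multiset.sum_map_sub]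
      congr 1
      refine Multiset.map_congr rfl fun t _ => ?_
      simp only [zsmul_eq_mul, nsmul_eq_mul]
      ring
    rw [h1, eq_neg_of_add_eq_zero_right hsum, hM]
    push_cast
    ring
  have hMp : ¬ (p : ℤ) ∣ M := by
    intro hdvd
    have h2 : (p : ℤ) ∣ a ^ D * n * k := (dvd_add_left (dvd_mul_right _ _)).1 hdvd
    have hp' := Nat.prime_iff_prime_int.1 hp
    rcases hp'.dvd_or_dvd h2 with h | h
    · rcases hp'.dvd_or_dvd h with h | h
      · have := Int.natAbs_dvd_natAbs.2 (hp'.dvd_of_dvd_pow h)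
        have := Nat.le_of_dvd (Int.natAbs_pos.2 ha0) this
        simp at this
        omega
      · exact hpn h
    · have := Nat.le_of_dvd (Nat.pos_of_ne_zero hk) (Int.natCast_dvd_natCast.1 h)
      omega
  have hM1 : (1 : ℝ) ≤ ‖(M : ℂ)‖ := by
    rw [Complex.norm_intCast]
    have : M ≠ 0 := by rintro h; exact hMp (h ▸ dvd_zero _)
    exact_mod_cast Int.one_le_abs this
  have hle : ‖(M : ℂ)‖ ≤ T.card * C * (C ^ (p - 1) / (p - 1).factorial) := by
    rw [hMC, norm_neg]
    refine (norm_multiset_sum_le _).trans ?_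
    rw [Multiset.map_map]
    refine (Multiset.sum_le_card_nsmul _ (C * (C ^ (p - 1) / (p - 1).factorial)) ?_).trans ?_
    · intro x hx
      obtain ⟨t, ht, rfl⟩ := Multiset.mem_map.1 hx
      simp only [Function.comp_apply, norm_mul, norm_pow, Complex.norm_intCast]
      refine (mul_le_mul_of_nonneg_left (hg (hroot t ht)) (by positivity)).trans_eq ?_
      have : C * (C ^ (p - 1) / (p - 1).factorial) = C ^ p / (p - 1).factorial := by
        rw [← mul_div_assoc, ← pow_succ', Nat.sub_add_cancel hp.one_le]
      rw [this, hC, mul_pow, ← pow_mul, mul_comm f.natDegree p, ← hD, mul_div_assoc]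
    · rw [Multiset.card_map, nsmul_eq_mul]
      exact (mul_assoc _ _ _).ge
  simp only [Function.comp_apply] at hsmall
  linarith

/-- The number `π` is transcendental over `ℚ`. -/
theorem transcendental_pi : Transcendental ℚ (Real.pi : ℂ) := by
  classical
  intro hpi
  have hI : IsAlgebraic ℚ Complex.I :=
    ⟨Polynomial.X ^ 2 + 1, by
      intro h
      have := congrArg (Polynomial.eval 0) h
      simp at this, by simp⟩
  let K := algebraicClosure ℚ ℂ
  have : IsAlgClosure ℚ K := algebraicClosure.isAlgClosure ℚ ℂ
  have : Normal ℚ K := IsAlgClosure.normal ℚ K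
  have : IsGalois ℚ K := {}
  let ι : K →+* ℂ := algebraMap K ℂ
  let θ : K := ⟨Real.pi * Complex.I, mem_algebraicClosure_iff.2 (hpi.mul hI)⟩
  have hθint : IsIntegral ℚ θ := Algebra.IsIntegral.isIntegral θ
  let s : Finset K := ((minpoly ℚ θ).rootSet_finite K).toFinset
  have hs : ∀ x, x ∈ s ↔ Polynomial.aeval x (minpoly ℚ θ) = 0 := by
    intro x
    simp [s, Polynomial.mem_rootSet, minpoly.ne_zero hθint]
  have hθs : θ ∈ s := (hs θ).2 (minpoly.aeval ℚ θ)
  have hsσ : ∀ σ : K ≃ₐ[ℚ] K, s.map σ.toEquiv.toEmbedding = s := by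
    intro σ
    refine Finset.eq_of_subset_of_card_le ?_ (by rw [Finset.card_map])
    intro y hy
    obtain ⟨x, hx, rfl⟩ := Finset.mem_map.1 hy
    rw [hs] at hx ⊢
    change Polynomial.aeval (σ.toAlgHom x) _ = 0
    rw [Polynomial.aeval_algHom_apply, hx, map_zero]
  -- The subset sums are kept with multiplicity, since they are the exponents in the expansion of ∏
  -- (1 + e^x) over the conjugates x of πi.
  let U : Multiset K := s.powerset.val.map fun S => ∑ x ∈ S, x
  have hUσ : ∀ σ : K ≃ₐ[ℚ] K, U.map σ = U := by
    intro σ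
    have h1 : s.powerset.map (Finset.mapEmbedding σ.toEquiv.toEmbedding).toEmbedding =
        s.powerset := by
      refine Finset.eq_of_subset_of_card_le ?_ (by rw [Finset.card_map])
      intro y hy
      obtain ⟨S, hS, rfl⟩ := Finset.mem_map.1 hy
      rw [Finset.mem_powerset] at hS ⊢
      rw [← hsσ σ]
      exact Finset.map_subset_map.2 hS
    change (s.powerset.val.map fun S => ∑ x ∈ S, x).map σ = s.powerset.val.map fun S => ∑ x ∈ S, x
    conv_rhs => rw [← h1, Finset.map_val, Multiset.map_map]
    rw [Multiset.map_map]
    refine Multiset.map_congr rfl fun S _ => ?_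
    simp [map_sum]
  have hprod : (U.map fun t => Complex.exp (ι t)).sum = 0 := by
    have h0 : ∏ x ∈ s, (1 + Complex.exp (ι x)) = 0 := by
      refine Finset.prod_eq_zero hθs ?_
      change 1 + Complex.exp (Real.pi * Complex.I) = 0
      rw [Complex.exp_pi_mul_I]
      ring
    rw [Finset.prod_one_add] at h0
    rw [← h0, Multiset.map_map]
    change ∑ S ∈ s.powerset, _ = _
    refine Finset.sum_congr rfl fun S _ => ?_
    rw [Function.comp_apply, map_sum, Complex.exp_sum]
  have hcount : U.count 0 ≠ 0 := by
    refine Multiset.count_ne_zero.2 (Multiset.mem_map.2 ⟨∅, ?_, by simp⟩)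
    exact Finset.mem_powerset.2 (Finset.empty_subset s)
  -- Each zero subset sum contributes e^0 = 1, so k is the multiplicity of 0 in U; the empty subset
  -- makes it positive.
  refine natCast_add_sum_exp_ne_zero ι (U.filter fun t => t ≠ 0) (by simp) ?_ hcount ?_
  · intro σ
    conv_rhs => rw [← hUσ σ, Multiset.filter_map]
    congr 1
    refine Multiset.filter_congr fun x _ => ?_
    simp
  · rw [← hprod]
    conv_rhs => rw [← Multiset.filter_add_not (fun t => t = 0) U]
    rw [Multiset.map_add, Multiset.sum_add, Multiset.filter_eq', Multiset.map_replicate]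
    simp

/-! ### The coth expansion and partial fractions over roots of unity. -/

/-- The Mittag-Leffler expansion of the hyperbolic cotangent of `πw/2`. -/
theorem hasSum_coth_expansion {w : ℂ} (hw : w.re ≠ 0) :
    HasSum (fun n : ℕ => 4 * w / (w ^ 2 + (2 * ((n : ℂ) + 1)) ^ 2))
      (Real.pi * (1 + 2 * (1 / (Complex.exp (Real.pi * w) - 1))) - 2 / w) := by
  have hw0 : w ≠ 0 := by rintro rfl; simp at hw
  -- This rotation turns the cotangent expansion at x into that of coth(πw/2) = 1 + 2/(e^(πw) - 1).
  set x : ℂ := Complex.I * w / 2 with hx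
  have hxim : x.im = w.re / 2 := by simp [hx]
  have hxc : x ∈ Complex.integerComplement := by
    rintro ⟨k, hk⟩
    have := congrArg Complex.im hk
    rw [hxim] at this
    simp only [Complex.intCast_im] at this
    exact hw (by linarith)
  have h := ((summable_cotTerm hxc).hasSum).mul_left Complex.I
  rw [← cot_series_rep' hxc] at h
  have hI := Complex.I_sq
  convert! h using 1
  · funext n
    rw [cotTerm_identity hxc]
    have hden : w ^ 2 + (2 * ((n : ℂ) + 1)) ^ 2 = -4 * ((x + (n + 1)) * (x - (n + 1))) := by
      rw [hx]; linear_combination w ^ 2 * hI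
    have hden0 : (x + (n + 1)) * (x - (n + 1)) ≠ 0 := by
      refine mul_ne_zero ?_ ?_
      · simpa using Complex.integerComplement_add_ne_zero hxc ((n : ℤ) + 1)
      · simpa [sub_eq_add_neg, add_comm] using Complex.integerComplement_add_ne_zero hxc (-((n : ℤ) + 1))
    have hnum : 4 * w = -4 * (Complex.I * (2 * x)) := by
      rw [hx]; linear_combination 4 * w * hI
    rw [hden, hnum]
    field_simp
  · rw [Complex.cot_pi_eq_exp_ratio]
    have hE : 2 * (Real.pi : ℂ) * Complex.I * x = -(Real.pi * w) := by
      rw [hx]; linear_combination (Real.pi : ℂ) * w * hI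
    have hne : Complex.exp (Real.pi * w) - 1 ≠ 0 := by
      intro h0
      have h1 := congrArg norm (sub_eq_zero.1 h0)
      rw [Complex.norm_exp, norm_one, Real.exp_eq_one_iff] at h1
      simp [Real.pi_ne_zero] at h1
      exact hw h1
    have hix : Complex.I * (1 / x) = 2 / w := by
      rw [hx]; field_simp [Complex.I_ne_zero]
    rw [mul_sub, hix, hE, Complex.exp_neg]
    congr 1
    have he := Complex.exp_ne_zero (Real.pi * w)
    have hne' : 1 - (Complex.exp (Real.pi * w))⁻¹ ≠ 0 := by
      intro h0; apply hne; field_simp at h0; simpa using h0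
    have hI0 := Complex.I_ne_zero
    field_simp
    ring

theorem sum_pow_eq_zero_of_ne_one {ζ : ℂ} {N : ℕ} (h1 : ζ ≠ 1) (hN : ζ ^ N = 1) :
    ∑ j ∈ Finset.range N, ζ ^ j = 0 := by
  have := geom_sum_mul ζ N
  rw [hN, sub_self] at this
  exact (mul_eq_zero.1 this).resolve_right (sub_ne_zero.2 h1)

/-- A partial fraction decomposition over the `N`-th roots of unity. -/
theorem sum_primitiveRoot_pow_div {p N : ℕ} (hNp : N = 2 * p + 1) {ζ : ℂ}
    (hζ : IsPrimitiveRoot ζ N) {A B : ℂ} (hAB : A ^ N + B ^ N ≠ 0) :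
    ∑ j ∈ Finset.range N, (ζ ^ j) ^ (p + 1) / (A + B * ζ ^ j) =
      N * (A ^ p * (-B) ^ p) / (A ^ N + B ^ N) := by
  have hodd : Odd N := ⟨p, hNp⟩
  -- As N is odd, A^N + B^N = A^N - (-Bζ^j)^N is divisible by A + Bζ^j for every j.
  have hfac : ∀ j, (∑ i ∈ Finset.range N, (-(B * ζ ^ j)) ^ i * A ^ (N - 1 - i)) *
      (A + B * ζ ^ j) = A ^ N + B ^ N := by
    intro j
    have := (Commute.all (-(B * ζ ^ j)) A).geom_sum₂_mul N
    rw [hodd.neg_pow, mul_pow, ← pow_mul, mul_comm j, pow_mul, hζ.pow_eq_one, one_pow] at this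
    linear_combination -this
  have hterm : ∀ j, (ζ ^ j) ^ (p + 1) / (A + B * ζ ^ j) =
      (∑ i ∈ Finset.range N, (-B) ^ i * A ^ (N - 1 - i) * (ζ ^ (p + 1 + i)) ^ j) /
        (A ^ N + B ^ N) := by
    intro j
    have hne : A + B * ζ ^ j ≠ 0 := fun h => hAB (by rw [← hfac j, h, mul_zero])
    rw [div_eq_div_iff hne hAB, ← hfac j, ← mul_assoc, Finset.mul_sum]
    congr 1
    refine Finset.sum_congr rfl fun i _ => ?_
    rw [neg_mul_eq_neg_mul, mul_pow, ← pow_mul, ← pow_mul, ← pow_mul, add_mul, pow_add,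
      mul_comm j, mul_comm j]
    ring
  rw [Finset.sum_congr rfl fun j _ => hterm j, ← Finset.sum_div, Finset.sum_comm]
  congr 1
  -- Orthogonality: the sum over j vanishes unless N divides p+1+i, which for i < N means i = p.
  rw [Finset.sum_eq_single p]
  · rw [← Finset.mul_sum, show p + 1 + p = N by omega, hζ.pow_eq_one,
      show N - 1 - p = p by omega]
    simp
    ring
  · intro i hi hip
    rw [← Finset.mul_sum, sum_pow_eq_zero_of_ne_one, mul_zero]
    · intro h
      obtain ⟨d, hd⟩ := (hζ.pow_eq_one_iff_dvd _).1 h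
      have hi' := Finset.mem_range.1 hi
      have : d = 1 := by
        have h1 : 0 < d := Nat.pos_of_ne_zero (by rintro rfl; omega)
        have h2 : d < 2 := by
          by_contra h2
          have := Nat.mul_le_mul_left N (not_lt.1 h2)
          omega
        omega
      subst this
      omega
    · rw [← pow_mul, mul_comm, pow_mul, hζ.pow_eq_one, one_pow]
  · intro h
    exact absurd (Finset.mem_range.2 (by omega)) h

/-- The `2N`-th root of unity `e^{iπj/N}`. -/
noncomputable def halfRoot (N j : ℕ) : ℂ :=
  Complex.exp (Complex.I * (Real.pi : ℂ) * (j : ℂ) / (N : ℂ))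

theorem halfRoot_pow {N : ℕ} (hN : N ≠ 0) (j : ℕ) : halfRoot N j ^ N = (-1) ^ j := by
  have hN' : (N : ℂ) ≠ 0 := by exact_mod_cast hN
  rw [halfRoot, ← Complex.exp_nat_mul, ← Complex.exp_pi_mul_I, ← Complex.exp_nat_mul]
  congr 1
  field_simp

theorem halfRoot_sq (N j : ℕ) :
    halfRoot N j ^ 2 = Complex.exp (2 * Real.pi * Complex.I / N) ^ j := by
  rw [halfRoot, ← Complex.exp_nat_mul, ← Complex.exp_nat_mul]
  congr 1
  push_cast
  ring

theorem halfRoot_ne_zero (N j : ℕ) : halfRoot N j ≠ 0 := Complex.exp_ne_zero _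

theorem halfRoot_re (N j : ℕ) : (halfRoot N j).re = Real.cos (Real.pi * j / N) := by
  rw [halfRoot, show Complex.I * (Real.pi : ℂ) * (j : ℂ) / (N : ℂ) =
    ((Real.pi * j / N : ℝ) : ℂ) * Complex.I by push_cast; ring, Complex.exp_ofReal_mul_I_re]

theorem halfRoot_re_pos {N j : ℕ} (hj : 2 * j < N) : 0 < (halfRoot N j).re := by
  rw [halfRoot_re]
  have hN : (0 : ℝ) < N := by exact_mod_cast (by omega : 0 < N)
  have hj' : (2 : ℝ) * j < N := by exact_mod_cast hj
  have hpi := Real.pi_pos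
  refine Real.cos_pos_of_mem_Ioo ⟨?_, ?_⟩
  · have : 0 ≤ Real.pi * j / N := by positivity
    linarith
  · rw [div_lt_iff₀ hN]
    nlinarith

/-- Reflection in the imaginary axis. -/
theorem halfRoot_sub {N j : ℕ} (hN : N ≠ 0) (hj : j ≤ N) :
    halfRoot N (N - j) = -(starRingEnd ℂ) (halfRoot N j) := by
  have hN' : (N : ℂ) ≠ 0 := by exact_mod_cast hN
  rw [halfRoot, halfRoot, ← Complex.exp_conj, Nat.cast_sub hj,
    show Complex.I * (Real.pi : ℂ) * ((N : ℂ) - j) / N =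
      Real.pi * Complex.I + -(Complex.I * Real.pi * j / N) by field_simp; ring,
    Complex.exp_add, Complex.exp_pi_mul_I]
  simp [neg_div]

theorem halfRoot_re_ne_zero {N j : ℕ} (hN : Odd N) (hj : j < N) : (halfRoot N j).re ≠ 0 := by
  obtain ⟨p, hp⟩ := hN
  rcases Nat.lt_or_ge (2 * j) N with h | h
  · exact (halfRoot_re_pos h).ne'
  · have h1 := halfRoot_re_pos (N := N) (j := N - j) (by omega)
    rw [halfRoot_sub (by omega) hj.le] at h1
    simp at h1
    exact h1.ne

/-- With ω = e^(iπj/N), (-1)^j = ω^N, so (-1)^j ω = (ω²)^(p+1), and ω² runs over the N-th roots of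
unity. This reduces to `sum_primitiveRoot_pow_div` with A = a², B = β². -/
theorem sum_neg_one_pow_halfRoot_div {p N : ℕ} (hNp : N = 2 * p + 1) {a β : ℝ} (ha : 0 < a)
    (hβ : 0 < β) :
    ∑ j ∈ Finset.range N, (-1 : ℂ) ^ j * (4 * (β * halfRoot N j) /
      ((β * halfRoot N j) ^ 2 + (a : ℂ) ^ 2)) =
      ((4 * ((-1) ^ p * N) * (a ^ (2 * p) * β ^ N / (a ^ (2 * N) + (β ^ N) ^ 2)) : ℝ) : ℂ) := by
  have hN : N ≠ 0 := by omega
  have hζ := Complex.isPrimitiveRoot_exp N hN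
  have hpos : (0 : ℝ) < (a ^ 2) ^ N + (β ^ 2) ^ N := by positivity
  have hAB : ((a : ℂ) ^ 2) ^ N + ((β : ℂ) ^ 2) ^ N ≠ 0 := by exact_mod_cast hpos.ne'
  have key := sum_primitiveRoot_pow_div hNp hζ hAB
  have hterm : ∀ j, (-1 : ℂ) ^ j * (4 * (β * halfRoot N j) /
      ((β * halfRoot N j) ^ 2 + (a : ℂ) ^ 2)) = 4 * β *
      ((Complex.exp (2 * Real.pi * Complex.I / N) ^ j) ^ (p + 1) /
        ((a : ℂ) ^ 2 + (β : ℂ) ^ 2 * Complex.exp (2 * Real.pi * Complex.I / N) ^ j)) := by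
    intro j
    rw [← halfRoot_sq, ← halfRoot_pow hN j, ← pow_mul, show 2 * (p + 1) = N + 1 by omega]
    ring
  rw [Finset.sum_congr rfl fun j _ => hterm j, ← Finset.mul_sum, key]
  push_cast
  rw [neg_pow ((β : ℂ) ^ 2) p, show (β : ℂ) ^ N = β * (β ^ 2) ^ p by rw [hNp]; ring,
    show ((β : ℂ) ^ 2) ^ N = ((β : ℂ) * (β ^ 2) ^ p) ^ 2 by rw [hNp]; ring,
    show (a : ℂ) ^ (2 * N) = (a ^ 2) ^ N by rw [pow_mul], pow_mul (a : ℂ) 2 p]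
  ring

/-- Here (-1)^j / ω = ω^(N-1) = (ζ^p)^j, and ζ^p is a nontrivial root of unity unless N = 1. These
are the polar terms 2/w of the coth expansions. -/
theorem sum_neg_one_pow_div_halfRoot {N : ℕ} (hN : Odd N) (β : ℂ) :
    ∑ j ∈ Finset.range N, (-1 : ℂ) ^ j * (2 / (β * halfRoot N j)) =
      if N = 1 then 2 / β else 0 := by
  obtain ⟨p, hp⟩ := hN
  have hN : N ≠ 0 := by omega
  have hζ := Complex.isPrimitiveRoot_exp N hN
  have hterm : ∀ j, (-1 : ℂ) ^ j * (2 / (β * halfRoot N j)) =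
      2 / β * (Complex.exp (2 * Real.pi * Complex.I / N) ^ p) ^ j := by
    intro j
    rw [← pow_mul, mul_comm p j, pow_mul, ← halfRoot_sq, ← halfRoot_pow hN j, ← pow_mul, hp,
      pow_succ, ← hp]
    have := halfRoot_ne_zero N j
    rw [mul_assoc, mul_div_assoc', mul_comm _ (2 : ℂ), mul_comm β, mul_div_mul_comm]
    field_simp
  rw [Finset.sum_congr rfl fun j _ => hterm j, ← Finset.mul_sum]
  split_ifs with h1
  · have : p = 0 := by omega
    subst this
    subst h1
    simp
  · rw [sum_pow_eq_zero_of_ne_one, mul_zero]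
    · intro h
      have := Nat.le_of_dvd (by omega) ((hζ.pow_eq_one_iff_dvd _).1 h)
      omega
    · rw [← pow_mul, mul_comm p, pow_mul, hζ.pow_eq_one, one_pow]

/-- The positive even number `2(n+1)`. -/
noncomputable def evenPos (n : ℕ) : ℝ := 2 * ((n + 1 : ℕ) : ℝ)

theorem evenPos_pos (n : ℕ) : 0 < evenPos n := by
  unfold evenPos
  positivity

/-- The Lambert kernel `1 / (exp(b^{1/N} π e^{iπj/N}) - 1)`. -/
noncomputable def rotatedKernel (N j : ℕ) (b : ℝ) : ℂ :=
  1 / (Complex.exp (((b ^ (1 / (N : ℝ)) : ℝ) : ℂ) * (Real.pi : ℂ) * halfRoot N j) - 1)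

theorem sum_range_neg_one_pow_of_odd {N : ℕ} (hN : Odd N) :
    ∑ j ∈ Finset.range N, (-1 : ℂ) ^ j = 1 := by
  have := neg_one_geom_sum (R := ℂ) (n := N)
  rw [this, if_neg (Nat.not_even_iff_odd.2 hN)]

/-- Summation over the first variable of the symmetric double series. -/
theorem hasSum_rotatedKernel {p N : ℕ} (hNp : N = 2 * p + 1) {b : ℝ} (hb : 0 < b) :
    HasSum (fun n : ℕ => 4 * ((-1) ^ p * N) * (evenPos n ^ (2 * p) * b /
        (evenPos n ^ (2 * N) + b ^ 2)))
      (Real.pi * (1 + 2 * ∑ j ∈ Finset.range N, (-1) ^ j * (rotatedKernel N j b).re) -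
        (if N = 1 then 2 / b else 0)) := by
  have hodd : Odd N := ⟨p, hNp⟩
  have hN : N ≠ 0 := by omega
  set β : ℝ := b ^ (1 / (N : ℝ)) with hβdef
  have hβ : 0 < β := Real.rpow_pos_of_pos hb _
  have hβN : β ^ N = b := by
    rw [hβdef, one_div, Real.rpow_inv_natCast_pow hb.le hN]
  have hre : ∀ j ∈ Finset.range N, ((β : ℂ) * halfRoot N j).re ≠ 0 := by
    intro j hj
    rw [Complex.re_ofReal_mul]
    exact mul_ne_zero hβ.ne' (halfRoot_re_ne_zero hodd (Finset.mem_range.1 hj))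
  -- The expansions at w = βω_j are added with signs (-1)^j, which makes their partial fractions
  -- collapse to one real term.
  have h := hasSum_sum (fun j hj => (hasSum_coth_expansion (hre j hj)).mul_left ((-1 : ℂ) ^ j))
  have hval : ∑ j ∈ Finset.range N, (-1 : ℂ) ^ j * (Real.pi * (1 + 2 * (1 / (Complex.exp
      (Real.pi * (β * halfRoot N j)) - 1))) - 2 / (β * halfRoot N j)) =
      Real.pi * (1 + 2 * ∑ j ∈ Finset.range N, (-1) ^ j * rotatedKernel N j b) -
        ((if N = 1 then 2 / b else 0 : ℝ) : ℂ) := by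
    simp_rw [mul_sub, Finset.sum_sub_distrib]
    rw [sum_neg_one_pow_div_halfRoot hodd]
    congr 1
    · have e : ∀ K : ℕ → ℂ, 1 + 2 * ∑ j ∈ Finset.range N, (-1) ^ j * K j =
          ∑ j ∈ Finset.range N, ((-1) ^ j + 2 * ((-1) ^ j * K j)) := by
        intro K
        rw [Finset.sum_add_distrib, sum_range_neg_one_pow_of_odd hodd, Finset.mul_sum]
      rw [e, Finset.mul_sum]
      refine Finset.sum_congr rfl fun j _ => ?_
      rw [rotatedKernel, ← hβdef, show (β : ℂ) * Real.pi * halfRoot N j =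
        Real.pi * (β * halfRoot N j) by ring]
      ring
    · split_ifs with h1
      · rw [h1, pow_one] at hβN
        rw [hβN]
        push_cast
        rfl
      · simp
  rw [hval] at h
  have h2 := Complex.hasSum_re h
  convert! h2 using 1
  · funext n
    have h3 := sum_neg_one_pow_halfRoot_div hNp (evenPos_pos n) hβ
    rw [hβN] at h3
    rw [← Complex.ofReal_re (4 * _ * _), ← h3]
    simp [evenPos]
  · have hs : (∑ j ∈ Finset.range N, (-1 : ℂ) ^ j * rotatedKernel N j b).re =
        ∑ j ∈ Finset.range N, (-1) ^ j * (rotatedKernel N j b).re := by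
      rw [Complex.re_sum]
      refine Finset.sum_congr rfl fun j _ => ?_
      rw [show (-1 : ℂ) ^ j = (((-1 : ℝ) ^ j : ℝ) : ℂ) by push_cast; rfl, Complex.re_ofReal_mul]
    rw [Complex.sub_re, Complex.ofReal_re, Complex.re_ofReal_mul, Complex.add_re, Complex.one_re,
      show (2 : ℂ) = ((2 : ℝ) : ℂ) by push_cast; rfl, Complex.re_ofReal_mul, hs]

/-- Summation over the second variable of the symmetric double series. -/
theorem hasSum_lambertKernel {a : ℝ} (ha : 0 < a) (N : ℕ) :
    HasSum (fun l : ℕ => 4 * a ^ N / (a ^ (2 * N) + evenPos l ^ 2))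
      (Real.pi * (1 + 2 * (1 / (Real.exp (a ^ N * Real.pi) - 1))) - 2 / a ^ N) := by
  have h := hasSum_coth_expansion (w := ((a ^ N : ℝ) : ℂ)) (by rw [Complex.ofReal_re]; positivity)
  rw [← Complex.hasSum_ofReal]
  convert! h using 1
  · funext l
    push_cast [evenPos]
    ring
  · push_cast
    rw [mul_comm ((a : ℂ) ^ N) (Real.pi : ℂ)]

/-! ### Even zeta sums, convergence and reflection. -/

theorem one_le_evenPos (n : ℕ) : 1 ≤ evenPos n := by
  unfold evenPos
  push_cast
  have : (0 : ℝ) ≤ n := n.cast_nonneg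
  linarith

theorem one_div_evenPos_pow (s n : ℕ) :
    1 / evenPos n ^ s = (2 ^ s)⁻¹ * (1 / ((n + 1 : ℕ) : ℝ) ^ s) := by
  rw [evenPos, mul_pow, one_div, mul_inv, one_div]

theorem summable_one_div_evenPos_pow {s : ℕ} (hs : 2 ≤ s) :
    Summable fun n => 1 / evenPos n ^ s := by
  simp_rw [one_div_evenPos_pow]
  exact ((summable_nat_add_iff 1).2 (Real.summable_one_div_nat_pow.2 hs)).mul_left _

/-- The sum `∑ 1 / a^s` over the positive even numbers `a`. -/
noncomputable def evenSum (s : ℕ) : ℝ := ∑' n, 1 / evenPos n ^ s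

theorem evenSum_pos {s : ℕ} (hs : 2 ≤ s) : 0 < evenSum s :=
  (summable_one_div_evenPos_pow hs).tsum_pos
    (fun n => by have := evenPos_pos n; positivity) 0 (by have := evenPos_pos 0; positivity)

theorem tsum_nat_succ_eq_evenSum (s : ℕ) :
    ∑' n : ℕ, 1 / ((n + 1 : ℕ) : ℝ) ^ s = 2 ^ s * evenSum s := by
  rw [evenSum, ← tsum_mul_left]
  refine tsum_congr fun n => ?_
  rw [one_div_evenPos_pow, mul_inv_cancel_left₀ (by positivity)]

theorem riemannZeta_eq_evenSum {s : ℕ} (hs : 2 ≤ s) :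
    riemannZeta s = ((2 ^ s * evenSum s : ℝ) : ℂ) := by
  rw [zeta_nat_eq_tsum_of_gt_one hs, ← tsum_nat_succ_eq_evenSum, Complex.ofReal_tsum]
  have hsum : Summable fun n : ℕ => 1 / (n : ℂ) ^ s := by
    simpa using Complex.summable_ofReal.2 (Real.summable_one_div_nat_pow.2 hs)
  rw [hsum.tsum_eq_zero_add]
  simp [show s ≠ 0 by omega]

/-- Euler's formula for ζ(2k). The rational factor is nonzero because the sum is positive. -/
theorem exists_rat_evenSum_eq {k : ℕ} (hk : k ≠ 0) :
    ∃ q : ℚ, q ≠ 0 ∧ evenSum (2 * k) = q * Real.pi ^ (2 * k) := by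
  have h := hasSum_zeta_nat hk
  have h2 : ∑' n : ℕ, 1 / ((n + 1 : ℕ) : ℝ) ^ (2 * k) = ∑' n : ℕ, 1 / (n : ℝ) ^ (2 * k) := by
    rw [h.summable.tsum_eq_zero_add]
    simp [hk]
  rw [tsum_nat_succ_eq_evenSum, h.tsum_eq] at h2
  let q : ℚ := (2 ^ (2 * k))⁻¹ * ((-1) ^ (k + 1) * 2 ^ (2 * k - 1) * bernoulli (2 * k) /
    (2 * k).factorial)
  have hq : evenSum (2 * k) = q * Real.pi ^ (2 * k) := by
    have h3 : evenSum (2 * k) = ((2 : ℝ) ^ (2 * k))⁻¹ * (2 ^ (2 * k) * evenSum (2 * k)) := by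
      rw [inv_mul_cancel_left₀ (by positivity)]
    rw [h3, h2]
    push_cast [q]
    ring
  refine ⟨q, ?_, hq⟩
  rintro h0
  have := evenSum_pos (s := 2 * k) (by omega)
  rw [hq, h0] at this
  simp at this

theorem lambertTerm_succ (N s n : ℕ) :
    lambertTerm N s (n + 1) =
      2 ^ s * (1 / evenPos n ^ s * (1 / (Real.exp (evenPos n ^ N * Real.pi) - 1))) := by
  rw [one_div_evenPos_pow, lambertTerm, zpow_neg, zpow_natCast, evenPos]
  field_simp

theorem rotatedTerm_succ (N s j n : ℕ) :
    rotatedTerm N s j (n + 1) =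
      2 ^ s * (1 / evenPos n ^ s * (rotatedKernel N j (evenPos n)).re) := by
  rw [one_div_evenPos_pow, rotatedTerm, rotatedKernel, evenPos, halfRoot]
  field_simp

theorem lambertTerm_succ_nonneg (N s n : ℕ) : 0 ≤ lambertTerm N s (n + 1) := by
  rw [lambertTerm_succ]
  have := evenPos_pos n
  have h1 : 0 ≤ Real.exp (evenPos n ^ N * Real.pi) - 1 := by
    rw [sub_nonneg]
    exact Real.one_le_exp (by positivity)
  positivity

theorem summable_lambertTerm (N : ℕ) {s : ℕ} (hs : 2 ≤ s) :
    Summable fun n => lambertTerm N s (n + 1) := by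
  refine Summable.of_nonneg_of_le (lambertTerm_succ_nonneg N s) (fun n => ?_)
    (((summable_one_div_evenPos_pow hs).mul_left (2 ^ s)))
  rw [lambertTerm_succ]
  have := evenPos_pos n
  have hexp : 1 ≤ Real.exp (evenPos n ^ N * Real.pi) - 1 := by
    have h1 : 1 ≤ evenPos n ^ N * Real.pi :=
      one_le_mul_of_one_le_of_one_le (one_le_pow₀ (one_le_evenPos n))
        (by linarith [Real.pi_gt_three])
    have := Real.add_one_le_exp (evenPos n ^ N * Real.pi)
    linarith
  gcongr
  refine mul_le_of_le_one_right (by positivity) ?_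
  rw [div_le_one (by linarith)]
  exact hexp

theorem norm_one_div_exp_sub_one_le {z : ℂ} {r : ℝ} (hr : 0 < r) (hz : r ≤ z.re) :
    ‖1 / (Complex.exp z - 1)‖ ≤ 1 / (Real.exp r - 1) := by
  have h1 : 0 < Real.exp r - 1 := by
    have := Real.one_lt_exp_iff.2 hr
    linarith
  have h2 : Real.exp r - 1 ≤ ‖Complex.exp z - 1‖ := by
    have := norm_sub_norm_le (Complex.exp z) 1
    rw [Complex.norm_exp, norm_one] at this
    have := Real.exp_le_exp.2 hz
    linarith
  rw [norm_div, norm_one]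
  exact one_div_le_one_div_of_le h1 h2

/-- For j < N/2 the root has positive real part, so the kernel is bounded uniformly in n and n^(-s)
gives convergence. -/
theorem summable_rotatedTerm_of_two_mul_lt {N s j : ℕ} (hs : 2 ≤ s) (hj : 2 * j < N) :
    Summable fun n => rotatedTerm N s j (n + 1) := by
  simp_rw [rotatedTerm_succ]
  refine Summable.mul_left _ ?_
  have hpos := halfRoot_re_pos hj
  set r : ℝ := Real.pi * (halfRoot N j).re with hr
  have hr0 : 0 < r := mul_pos Real.pi_pos hpos
  refine Summable.of_norm_bounded
    ((summable_one_div_evenPos_pow hs).mul_right (1 / (Real.exp r - 1))) fun n => ?_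
  have hn := evenPos_pos n
  rw [norm_mul, Real.norm_of_nonneg (by positivity : (0 : ℝ) ≤ 1 / evenPos n ^ s)]
  gcongr
  rw [Real.norm_eq_abs]
  refine (Complex.abs_re_le_norm _).trans (norm_one_div_exp_sub_one_le hr0 ?_)
  rw [mul_assoc, Complex.re_ofReal_mul, Complex.re_ofReal_mul, ← hr]
  exact le_mul_of_one_le_left hr0.le (Real.one_le_rpow (one_le_evenPos n) (by positivity))

/-- Replacing j by N - j sends the exponent z to minus its conjugate, and 1/(e^(-z) - 1) = -1 -
1/(e^z - 1). This carries indices above N/2 back to those below. -/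
theorem rotatedKernel_reflect_re {N j : ℕ} (hN : Odd N) (hj : j < N) {b : ℝ} (hb : 0 < b) :
    (rotatedKernel N (N - j) b).re = -1 - (rotatedKernel N j b).re := by
  have hβ : 0 < b ^ (1 / (N : ℝ)) := Real.rpow_pos_of_pos hb _
  rw [rotatedKernel, rotatedKernel, halfRoot_sub hN.pos.ne' hj.le]
  set z : ℂ := ((b ^ (1 / (N : ℝ)) : ℝ) : ℂ) * (Real.pi : ℂ) * halfRoot N j with hz
  have hzre : z.re ≠ 0 := by
    rw [hz, mul_assoc, Complex.re_ofReal_mul, Complex.re_ofReal_mul]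
    exact mul_ne_zero hβ.ne' (mul_ne_zero Real.pi_ne_zero (halfRoot_re_ne_zero hN hj))
  have hne : Complex.exp z - 1 ≠ 0 := by
    intro h0
    have h1 := congrArg norm (sub_eq_zero.1 h0)
    rw [Complex.norm_exp, norm_one, Real.exp_eq_one_iff] at h1
    exact hzre h1
  have hneg : 1 / (Complex.exp (-z) - 1) = -1 - 1 / (Complex.exp z - 1) := by
    have he := Complex.exp_ne_zero z
    have hne' : (Complex.exp z)⁻¹ - 1 ≠ 0 := by
      intro h0
      rw [sub_eq_zero, inv_eq_one] at h0
      exact hne (sub_eq_zero.2 h0)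
    have hne2 : 1 - Complex.exp z ≠ 0 := by rwa [← neg_sub, neg_ne_zero]
    rw [Complex.exp_neg]
    field_simp
    ring
  have hconj : 1 / (Complex.exp (((b ^ (1 / (N : ℝ)) : ℝ) : ℂ) * (Real.pi : ℂ) *
      -(starRingEnd ℂ) (halfRoot N j)) - 1) = (starRingEnd ℂ) (1 / (Complex.exp (-z) - 1)) := by
    rw [map_div₀, map_sub, ← Complex.exp_conj, hz]
    simp
  rw [hconj, Complex.conj_re, hneg]
  simp

theorem rotatedTerm_reflect {N j : ℕ} (s : ℕ) (hN : Odd N) (hj : j < N) (n : ℕ) :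
    rotatedTerm N s (N - j) (n + 1) =
      -(2 ^ s * (1 / evenPos n ^ s)) - rotatedTerm N s j (n + 1) := by
  rw [rotatedTerm_succ, rotatedTerm_succ, rotatedKernel_reflect_re hN hj (evenPos_pos n)]
  ring

theorem summable_rotatedTerm {N s j : ℕ} (hN : Odd N) (hs : 2 ≤ s) (hj : j < N) :
    Summable fun n => rotatedTerm N s j (n + 1) := by
  obtain ⟨p, hp⟩ := hN
  rcases Nat.lt_or_ge (2 * j) N with h | h
  · exact summable_rotatedTerm_of_two_mul_lt hs h
  · have h1 := ((summable_one_div_evenPos_pow hs).mul_left (2 ^ s)).neg.sub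
      (summable_rotatedTerm_of_two_mul_lt (N := N) (s := s) (j := N - j) hs (by omega))
    refine h1.congr fun n => ?_
    rw [← rotatedTerm_reflect s ⟨p, hp⟩ (by omega) n, Nat.sub_sub_self hj.le]

theorem rotatedSeries_reflect {N s j : ℕ} (hN : Odd N) (hs : 2 ≤ s) (hj : j < N) :
    rotatedSeries N s (N - j) = -(2 ^ s * evenSum s) - rotatedSeries N s j := by
  have h1 := ((summable_one_div_evenPos_pow hs).mul_left (2 ^ s)).neg
  rw [rotatedSeries, tsum_congr (rotatedTerm_reflect s hN hj),
    h1.tsum_sub (summable_rotatedTerm hN hs hj), tsum_neg, tsum_mul_left, evenSum, rotatedSeries]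

theorem hasSum_evenPos_mul_lambertKernel (N : ℕ) {s : ℕ} (hs : 2 ≤ s) :
    HasSum (fun n => 1 / evenPos n ^ s * (1 / (Real.exp (evenPos n ^ N * Real.pi) - 1)))
      ((2 ^ s)⁻¹ * lambertSeries N s) := by
  have h := (summable_lambertTerm N hs).hasSum.mul_left (2 ^ s : ℝ)⁻¹
  refine h.congr_fun fun n => ?_
  rw [lambertTerm_succ, inv_mul_cancel_left₀ (by positivity)]

theorem hasSum_evenPos_mul_rotatedKernel {N s j : ℕ} (hN : Odd N) (hs : 2 ≤ s) (hj : j < N) :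
    HasSum (fun n => 1 / evenPos n ^ s * (rotatedKernel N j (evenPos n)).re)
      ((2 ^ s)⁻¹ * rotatedSeries N s j) := by
  have h := (summable_rotatedTerm hN hs hj).hasSum.mul_left (2 ^ s : ℝ)⁻¹
  refine h.congr_fun fun n => ?_
  rw [rotatedTerm_succ, inv_mul_cancel_left₀ (by positivity)]

/-! ### The double series, summed in both orders. -/

/-- Dividing by u + v separates the variables: the kernel 1/(u + v) disappears and only products of
a power of u and a power of v remain. -/
theorem inv_pow_sub_inv_neg_pow {u v : ℝ} (hu : u ≠ 0) (hv : v ≠ 0) (m : ℕ) :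
    (u + v) * ∑ i ∈ Finset.range m, (-1) ^ (m - 1 - i) * (1 / u ^ (i + 1) * (1 / v ^ (m - i))) =
      1 / u ^ m - (-1) ^ m * (1 / v ^ m) := by
  induction m with
  | zero => simp
  | succ m ih =>
    have hstep : ∀ i ∈ Finset.range m, (-1 : ℝ) ^ (m + 1 - 1 - i) *
        (1 / u ^ (i + 1) * (1 / v ^ (m + 1 - i))) =
        -(1 / v) * ((-1) ^ (m - 1 - i) * (1 / u ^ (i + 1) * (1 / v ^ (m - i)))) := by
      intro i hi
      have hi' := Finset.mem_range.1 hi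
      rw [show m + 1 - 1 - i = m - 1 - i + 1 by omega, show m + 1 - i = m - i + 1 by omega]
      field_simp
      ring
    rw [Finset.sum_range_succ, Finset.sum_congr rfl hstep, ← Finset.mul_sum, mul_add,
      mul_left_comm, ih]
    simp only [Nat.add_sub_cancel, Nat.sub_self, pow_zero, Nat.add_sub_cancel_left]
    field_simp
    ring

theorem hasSum_evenPos_pow_div {s t : ℕ} (h : t + 2 ≤ s) :
    HasSum (fun n => evenPos n ^ t / evenPos n ^ s) (evenSum (s - t)) := by
  refine ((summable_one_div_evenPos_pow (s := s - t) (by omega)).hasSum).congr_fun fun n => ?_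
  have := evenPos_pos n
  rw [div_eq_div_iff (by positivity) (by positivity), ← pow_add, one_mul]
  congr 1
  omega

/-- The value of the double series summed with the second variable inside. -/
theorem hasSum_sum_lambert {p N : ℕ} (hNp : N = 2 * p + 1) {m : ℕ} (hm : 1 ≤ m)
    (hF : Summable fun x : ℕ × ℕ => evenPos x.1 ^ (2 * p) * (1 / (evenPos x.1 ^ (2 * N)) ^ m) *
      (1 / (evenPos x.1 ^ (2 * N) + evenPos x.2 ^ 2))) :
    HasSum (fun x : ℕ × ℕ => evenPos x.1 ^ (2 * p) * (1 / (evenPos x.1 ^ (2 * N)) ^ m) *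
      (1 / (evenPos x.1 ^ (2 * N) + evenPos x.2 ^ 2)))
      (1 / 4 * (Real.pi * (evenSum (2 * N * m + 1) +
        2 * ((2 ^ (2 * N * m + 1))⁻¹ * lambertSeries N (2 * N * m + 1))) -
        2 * evenSum (2 * N * m + 1 + N))) := by
  have hNm : 2 * 1 ≤ 2 * N * m := by
    rw [mul_assoc]; exact Nat.mul_le_mul_left 2 (Nat.mul_pos (by omega) hm)
  have hin : ∀ n, HasSum (fun l => evenPos n ^ (2 * p) * (1 / (evenPos n ^ (2 * N)) ^ m) *
      (1 / (evenPos n ^ (2 * N) + evenPos l ^ 2)))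
      (1 / 4 * (Real.pi * (1 / evenPos n ^ (2 * N * m + 1) +
        2 * (1 / evenPos n ^ (2 * N * m + 1) *
          (1 / (Real.exp (evenPos n ^ N * Real.pi) - 1)))) -
        2 * (1 / evenPos n ^ (2 * N * m + 1 + N)))) := by
    intro n
    have ha := evenPos_pos n
    -- The numerator a^(2p) equals a^N / a because N = 2p+1; this is the source of the odd exponent
    -- 2Nm+1.
    have h := (hasSum_lambertKernel ha N).mul_left (1 / (4 * evenPos n ^ (2 * N * m + 1)))
    convert! h using 1
    · funext l
      have hb := evenPos_pos l
      have hden : evenPos n ^ (2 * N) + evenPos l ^ 2 ≠ 0 := by positivity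
      rw [← pow_mul, pow_succ (evenPos n) (2 * N * m),
        show evenPos n ^ N = evenPos n ^ (2 * p) * evenPos n by rw [hNp, pow_succ]]
      field_simp
    · rw [pow_add _ _ N]
      generalize 1 / (Real.exp (evenPos n ^ N * Real.pi) - 1) = L
      field_simp
  have h1 := hF.hasSum.prod_fiberwise hin
  have h2 := ((((summable_one_div_evenPos_pow (s := 2 * N * m + 1) (by omega)).hasSum.add
    ((hasSum_evenPos_mul_lambertKernel N (s := 2 * N * m + 1) (by omega)).mul_left 2)).mul_left
      Real.pi).sub ((summable_one_div_evenPos_pow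
        (s := 2 * N * m + 1 + N) (by omega)).hasSum.mul_left 2)).mul_left (1 / 4)
  have h3 := h1.unique h2
  have h4 := hF.hasSum
  rw [h3] at h4
  exact h4

/-- The value of the double series summed with the first variable inside. -/
theorem hasSum_sum_rotated {p N : ℕ} (hNp : N = 2 * p + 1) {m : ℕ} (hm : 1 ≤ m)
    (hG : Summable fun x : ℕ × ℕ => evenPos x.1 ^ (2 * p) * (1 / (evenPos x.2 ^ 2) ^ m) *
      (1 / (evenPos x.1 ^ (2 * N) + evenPos x.2 ^ 2))) :
    HasSum (fun x : ℕ × ℕ => evenPos x.1 ^ (2 * p) * (1 / (evenPos x.2 ^ 2) ^ m) *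
      (1 / (evenPos x.1 ^ (2 * N) + evenPos x.2 ^ 2)))
      (1 / (4 * ((-1) ^ p * N)) * (Real.pi * (evenSum (2 * m + 1) +
        2 * ((2 ^ (2 * m + 1))⁻¹ * ∑ j ∈ Finset.range N, (-1) ^ j * rotatedSeries N (2 * m + 1) j)) -
        (if N = 1 then 2 else 0) * evenSum (2 * m + 2))) := by
  have hodd : Odd N := ⟨p, hNp⟩
  have hN0 : (N : ℝ) ≠ 0 := by exact_mod_cast hodd.pos.ne'
  have hin : ∀ l, HasSum (fun n => evenPos n ^ (2 * p) * (1 / (evenPos l ^ 2) ^ m) *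
      (1 / (evenPos n ^ (2 * N) + evenPos l ^ 2)))
      (1 / (4 * ((-1) ^ p * N)) * (Real.pi * (1 / evenPos l ^ (2 * m + 1) +
        2 * ∑ j ∈ Finset.range N, (-1) ^ j * (1 / evenPos l ^ (2 * m + 1) *
          (rotatedKernel N j (evenPos l)).re)) -
        (if N = 1 then 2 else 0) * (1 / evenPos l ^ (2 * m + 2)))) := by
    intro l
    have hb := evenPos_pos l
    have h := (hasSum_rotatedKernel hNp hb).mul_left
      (1 / (4 * ((-1) ^ p * N)) * (1 / evenPos l ^ (2 * m + 1)))
    convert! h using 1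
    · funext n
      have ha := evenPos_pos n
      have hden : evenPos n ^ (2 * N) + evenPos l ^ 2 ≠ 0 := by positivity
      rw [← pow_mul, pow_succ (evenPos l) (2 * m)]
      field_simp
    · have hs : ∑ j ∈ Finset.range N, (-1) ^ j * (1 / evenPos l ^ (2 * m + 1) *
          (rotatedKernel N j (evenPos l)).re) = 1 / evenPos l ^ (2 * m + 1) *
          ∑ j ∈ Finset.range N, (-1) ^ j * (rotatedKernel N j (evenPos l)).re := by
        rw [Finset.mul_sum]
        exact Finset.sum_congr rfl fun j _ => by ring
      have hε : (if N = 1 then (2 : ℝ) / evenPos l else 0) =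
          (if N = 1 then 2 else 0) * (1 / evenPos l) := by
        split_ifs
        · ring
        · ring
      rw [hs, hε, show 2 * m + 2 = 2 * m + 1 + 1 by ring, pow_succ _ (2 * m + 1)]
      field_simp
  -- The coordinates are swapped so that the fibrewise summation runs over a first.
  have hval := ((Equiv.prodComm ℕ ℕ).hasSum_iff (a := tsum _)).2 hG.hasSum
  have h1 := hval.prod_fiberwise hin
  have hsum : HasSum (fun l => ∑ j ∈ Finset.range N, (-1 : ℝ) ^ j *
      (1 / evenPos l ^ (2 * m + 1) * (rotatedKernel N j (evenPos l)).re))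
      ((2 ^ (2 * m + 1))⁻¹ * ∑ j ∈ Finset.range N, (-1) ^ j * rotatedSeries N (2 * m + 1) j) := by
    rw [Finset.mul_sum]
    have := hasSum_sum (fun j hj => (hasSum_evenPos_mul_rotatedKernel hodd
      (s := 2 * m + 1) (by omega) (Finset.mem_range.1 hj)).mul_left ((-1 : ℝ) ^ j))
    convert! this using 1
    exact Finset.sum_congr rfl fun j _ => by ring
  have h2 := ((((summable_one_div_evenPos_pow (s := 2 * m + 1) (by omega)).hasSum.add
    (hsum.mul_left 2)).mul_left Real.pi).sub ((summable_one_div_evenPos_pow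
      (s := 2 * m + 2) (by omega)).hasSum.mul_left (if N = 1 then 2 else 0))).mul_left
        (1 / (4 * ((-1 : ℝ) ^ p * N)))
  have h3 := h1.unique h2
  have h4 := hG.hasSum
  rw [h3] at h4
  exact h4

theorem hasSum_evenPos_prod {s t r : ℕ} (h : t + 2 ≤ s) (hr : 2 ≤ r) :
    HasSum (fun x : ℕ × ℕ => evenPos x.1 ^ t / evenPos x.1 ^ s * (1 / evenPos x.2 ^ r))
      (evenSum (s - t) * evenSum r) := by
  have hpos := evenPos_pos
  have h1 := hasSum_evenPos_pow_div h
  have h2 : HasSum (fun n => 1 / evenPos n ^ r) (evenSum r) :=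
    (summable_one_div_evenPos_pow hr).hasSum
  have h3 : Summable fun x : ℕ × ℕ => evenPos x.1 ^ t / evenPos x.1 ^ s * (1 / evenPos x.2 ^ r) :=
    Summable.mul_of_nonneg (f := fun n => evenPos n ^ t / evenPos n ^ s)
      (g := fun n => 1 / evenPos n ^ r) h1.summable h2.summable
      (fun n => by have := hpos n; simp only [Pi.zero_apply]; positivity)
      (fun n => by have := hpos n; simp only [Pi.zero_apply]; positivity)
  exact HasSum.mul (f := fun n => evenPos n ^ t / evenPos n ^ s)
    (g := fun n => 1 / evenPos n ^ r) h1 h2 h3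

/-- The relation between the generalized Lambert series and the rotated series. -/
theorem lambert_sub_rotated_eq {p N : ℕ} (hNp : N = 2 * p + 1) {m : ℕ} (hm : 1 ≤ m) :
    1 / 4 * (Real.pi * (evenSum (2 * N * m + 1) +
        2 * ((2 ^ (2 * N * m + 1))⁻¹ * lambertSeries N (2 * N * m + 1))) -
        2 * evenSum (2 * N * m + 1 + N)) -
      (-1) ^ m * (1 / (4 * ((-1) ^ p * N)) * (Real.pi * (evenSum (2 * m + 1) +
        2 * ((2 ^ (2 * m + 1))⁻¹ * ∑ j ∈ Finset.range N, (-1) ^ j * rotatedSeries N (2 * m + 1) j)) -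
        (if N = 1 then 2 else 0) * evenSum (2 * m + 2))) =
      ∑ i ∈ Finset.range m, (-1) ^ (m - 1 - i) *
        (evenSum (2 * N * (i + 1) - 2 * p) * evenSum (2 * (m - i))) := by
  have hpos := evenPos_pos
  have hF : Summable fun x : ℕ × ℕ => evenPos x.1 ^ (2 * p) * (1 / (evenPos x.1 ^ (2 * N)) ^ m) *
      (1 / (evenPos x.1 ^ (2 * N) + evenPos x.2 ^ 2)) := by
    have hle : 2 * p + 2 ≤ 2 * N * m := by
      calc 2 * p + 2 ≤ 2 * N * 1 := by omega
        _ ≤ 2 * N * m := Nat.mul_le_mul_left _ hm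
    have h1 := (hasSum_evenPos_prod hle (le_refl 2)).summable
    refine Summable.of_nonneg_of_le (fun x => ?_) (fun x => ?_) h1
    · have := hpos x.1
      have := hpos x.2
      positivity
    · have := hpos x.1
      have := hpos x.2
      rw [← pow_mul, mul_one_div (evenPos x.1 ^ (2 * p))]
      gcongr
      exact le_add_of_nonneg_left (by positivity)
  have hH : HasSum (fun x : ℕ × ℕ => ∑ i ∈ Finset.range m, (-1 : ℝ) ^ (m - 1 - i) *
      (evenPos x.1 ^ (2 * p) / evenPos x.1 ^ (2 * N * (i + 1)) *
        (1 / evenPos x.2 ^ (2 * (m - i)))))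
      (∑ i ∈ Finset.range m, (-1) ^ (m - 1 - i) *
        (evenSum (2 * N * (i + 1) - 2 * p) * evenSum (2 * (m - i)))) := by
    refine hasSum_sum fun i hi => (hasSum_evenPos_prod ?_ ?_).mul_left _
    · calc 2 * p + 2 ≤ 2 * N * 1 := by omega
        _ ≤ 2 * N * (i + 1) := Nat.mul_le_mul_left _ (by omega)
    · have := Finset.mem_range.1 hi
      omega
  have hFG : ∀ x : ℕ × ℕ, evenPos x.1 ^ (2 * p) * (1 / (evenPos x.1 ^ (2 * N)) ^ m) *
      (1 / (evenPos x.1 ^ (2 * N) + evenPos x.2 ^ 2)) - (-1) ^ m *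
      (evenPos x.1 ^ (2 * p) * (1 / (evenPos x.2 ^ 2) ^ m) *
      (1 / (evenPos x.1 ^ (2 * N) + evenPos x.2 ^ 2))) =
      ∑ i ∈ Finset.range m, (-1) ^ (m - 1 - i) * (evenPos x.1 ^ (2 * p) /
      evenPos x.1 ^ (2 * N * (i + 1)) * (1 / evenPos x.2 ^ (2 * (m - i)))) := by
    intro x
    have h1 := hpos x.1
    have h2 := hpos x.2
    have key := inv_pow_sub_inv_neg_pow (u := evenPos x.1 ^ (2 * N)) (v := evenPos x.2 ^ 2)
      (by positivity) (by positivity) m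
    have hden : evenPos x.1 ^ (2 * N) + evenPos x.2 ^ 2 ≠ 0 := by positivity
    have : ∑ i ∈ Finset.range m, (-1 : ℝ) ^ (m - 1 - i) * (evenPos x.1 ^ (2 * p) /
        evenPos x.1 ^ (2 * N * (i + 1)) * (1 / evenPos x.2 ^ (2 * (m - i)))) =
        evenPos x.1 ^ (2 * p) * ∑ i ∈ Finset.range m, (-1 : ℝ) ^ (m - 1 - i) *
        (1 / (evenPos x.1 ^ (2 * N)) ^ (i + 1) * (1 / (evenPos x.2 ^ 2) ^ (m - i))) := by
      rw [Finset.mul_sum]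
      refine Finset.sum_congr rfl fun i _ => ?_
      rw [← pow_mul, ← pow_mul]
      ring
    rw [this]
    rw [mul_comm, ← eq_div_iff hden] at key
    rw [key]
    ring
  have hm1 : ((-1 : ℝ) ^ m) * (-1) ^ m = 1 := by
    rw [← mul_pow]; simp
  have hG : Summable fun x : ℕ × ℕ => evenPos x.1 ^ (2 * p) * (1 / (evenPos x.2 ^ 2) ^ m) *
      (1 / (evenPos x.1 ^ (2 * N) + evenPos x.2 ^ 2)) := by
    -- Convergence of the second double series follows from that of the first and of the separated
    -- products.
    refine ((hF.sub hH.summable).mul_left ((-1 : ℝ) ^ m)).congr fun x => ?_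
    rw [← hFG x, sub_sub_cancel, ← mul_assoc, hm1, one_mul]
  have h1 := (hasSum_sum_lambert hNp hm hF).sub
    ((hasSum_sum_rotated hNp hm hG).mul_left ((-1 : ℝ) ^ m))
  exact (h1.congr_fun fun x => (hFG x).symm).unique hH

/-! ### The combination as a polynomial in π. -/

/-- The combination of the zeta values, the Lambert series and the rotated series which is a
polynomial in `π`. -/
noncomputable def lambertCombination (N m : ℕ) : ℝ :=
  evenSum (2 * N * m + 1) + 2 * ((2 ^ (2 * N * m + 1))⁻¹ * lambertSeries N (2 * N * m + 1)) -
    (-1) ^ m * ((-1 : ℝ) ^ ((N - 1) / 2) * N)⁻¹ * (evenSum (2 * m + 1) +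
      2 * ((2 ^ (2 * m + 1))⁻¹ * ∑ j ∈ Finset.range N, (-1) ^ j * rotatedSeries N (2 * m + 1) j))

/-- The combination involves all j < N, but only j ≤ (N-1)/2 are given; reflection supplies the
others modulo rational multiples of `evenSum (2 * m + 1)`. -/
theorem lambertCombination_mem {N m : ℕ} (hN : Odd N) (hm : 1 ≤ m) (W : Submodule ℚ ℂ)
    (hz : (evenSum (2 * N * m + 1) : ℂ) ∈ W)
    (hL : (lambertSeries N (2 * N * m + 1) : ℂ) ∈ W)
    (hz' : (evenSum (2 * m + 1) : ℂ) ∈ W)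
    (hR : ∀ j ≤ (N - 1) / 2, (rotatedSeries N (2 * m + 1) j : ℂ) ∈ W) :
    (lambertCombination N m : ℂ) ∈ W := by
  have hq : ∀ (q : ℚ) {x : ℂ}, x ∈ W → (q : ℂ) * x ∈ W := by
    intro q x hx
    have := W.smul_mem q hx
    rwa [Rat.smul_def] at this
  have hR' : ∀ j < N, (rotatedSeries N (2 * m + 1) j : ℂ) ∈ W := by
    intro j hj
    by_cases h : j ≤ (N - 1) / 2
    · exact hR j h
    · obtain ⟨p, hp⟩ := hN
      have h1 := rotatedSeries_reflect (N := N) (s := 2 * m + 1) (j := N - j) ⟨p, hp⟩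
        (by omega) (by omega)
      rw [Nat.sub_sub_self hj.le] at h1
      rw [h1]
      push_cast
      refine W.sub_mem (W.neg_mem ?_) (hR _ (by omega))
      simpa using hq (2 ^ (2 * m + 1)) hz'
  have hsum : ((∑ j ∈ Finset.range N, (-1) ^ j * rotatedSeries N (2 * m + 1) j : ℝ) : ℂ) ∈ W := by
    push_cast
    refine W.sum_mem fun j hj => ?_
    simpa using hq ((-1) ^ j) (hR' j (Finset.mem_range.1 hj))
  have h1 := hq (2 * (2 ^ (2 * N * m + 1))⁻¹) hL
  have h2 := hq (2 * (2 ^ (2 * m + 1))⁻¹) hsum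
  have h3 := W.sub_mem (W.add_mem hz h1)
    (hq ((-1) ^ m * ((-1 : ℚ) ^ ((N - 1) / 2) * N)⁻¹) (W.add_mem hz' h2))
  convert! h3 using 1
  rw [lambertCombination]
  push_cast
  ring

theorem rotatedSeries_one_zero_nonneg (s : ℕ) : 0 ≤ rotatedSeries 1 s 0 := by
  refine tsum_nonneg fun n => ?_
  have hn := evenPos_pos n
  rw [rotatedTerm_succ]
  have h1 : 0 ≤ Real.exp (evenPos n * Real.pi) - 1 := by
    rw [sub_nonneg]
    exact Real.one_le_exp (by positivity)
  have : rotatedKernel 1 0 (evenPos n) =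
      ((1 / (Real.exp (evenPos n * Real.pi) - 1) : ℝ) : ℂ) := by
    simp [rotatedKernel, halfRoot]
  rw [this, Complex.ofReal_re]
  positivity

/-- For odd m the sign -(-1)^m is positive, so nothing cancels. This is the nonvanishing input for N
= 1. -/
theorem lambertCombination_one_pos {m : ℕ} (hm : Odd m) : 0 < lambertCombination 1 m := by
  have hm1 := hm.pos
  have h1 := evenSum_pos (s := 2 * m + 1) (by omega)
  have h2 : 0 ≤ lambertSeries 1 (2 * m + 1) := tsum_nonneg (lambertTerm_succ_nonneg 1 _)
  have h3 := rotatedSeries_one_zero_nonneg (2 * m + 1)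
  rw [lambertCombination, hm.neg_one_pow]
  simp only [mul_one, Nat.sub_self, Nat.zero_div, pow_zero, Nat.cast_one, inv_one,
    Finset.range_one, Finset.sum_singleton, one_mul, neg_mul, sub_neg_eq_add]
  positivity

theorem pi_mul_lambertCombination {p N : ℕ} (hNp : N = 2 * p + 1) {m : ℕ} (hm : 1 ≤ m) :
    Real.pi * lambertCombination N m = 2 * evenSum (2 * (N * m + p + 1)) -
      (-1) ^ m * ((-1 : ℝ) ^ p * N)⁻¹ * ((if N = 1 then 2 else 0) * evenSum (2 * (m + 1))) +
      4 * ∑ i ∈ Finset.range m, (-1) ^ (m - 1 - i) *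
        (evenSum (2 * (N * (i + 1) - p)) * evenSum (2 * (m - i))) := by
  have h := lambert_sub_rotated_eq hNp hm
  have hp : (N - 1) / 2 = p := by omega
  have hN0 : (N : ℝ) ≠ 0 := by exact_mod_cast (by omega : N ≠ 0)
  have h1 : ∀ i, 2 * (N * (i + 1) - p) = 2 * N * (i + 1) - 2 * p := by
    intro i
    rw [Nat.mul_sub, mul_assoc]
  simp_rw [h1]
  rw [← h, lambertCombination, hp, show 2 * (N * m + p + 1) = 2 * N * m + 1 + N by
    rw [mul_assoc]; omega, show 2 * (m + 1) = 2 * m + 2 by ring, one_div (4 * _), mul_inv]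
  ring

open Polynomial in
/-- The combination of series is a polynomial of large degree in `π`. -/
theorem exists_polynomial_lambertCombination {N m : ℕ} (hN : Odd N) (hm : 1 ≤ m)
    (hNm : N = 1 → Odd m) :
    ∃ P : ℚ[X], m ≤ P.natDegree ∧ (lambertCombination N m : ℂ) = aeval (Real.pi : ℂ) P := by
  obtain ⟨p, hp⟩ := hN
  have hpi : Real.pi ≠ 0 := Real.pi_ne_zero
  have hex : ∀ k, ∃ q : ℚ, k ≠ 0 → q ≠ 0 ∧ evenSum (2 * k) = q * Real.pi ^ (2 * k) := by
    intro k
    by_cases hk : k = 0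
    · exact ⟨0, fun h => absurd hk h⟩
    · obtain ⟨q, hq⟩ := exists_rat_evenSum_eq hk
      exact ⟨q, fun _ => hq⟩
  choose q hq using hex
  have hmain := pi_mul_lambertCombination hp hm
  have hlow : ∀ i, p < N * (i + 1) := by
    intro i
    calc p < N * 1 := by omega
      _ ≤ N * (i + 1) := Nat.mul_le_mul_left _ (by omega)
  have hsum : ∑ i ∈ Finset.range m, (-1) ^ (m - 1 - i) *
      (evenSum (2 * (N * (i + 1) - p)) * evenSum (2 * (m - i))) =
      Real.pi * ∑ i ∈ Finset.range m, (((-1) ^ (m - 1 - i) * (q (N * (i + 1) - p) * q (m - i)) : ℚ) : ℝ)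
        * Real.pi ^ (2 * (N * (i + 1) - p + (m - i)) - 1) := by
    rw [Finset.mul_sum]
    refine Finset.sum_congr rfl fun i hi => ?_
    have hi' := Finset.mem_range.1 hi
    have hl := hlow i
    rw [(hq (N * (i + 1) - p) (by omega)).2, (hq (m - i) (by omega)).2]
    have : Real.pi ^ (2 * (N * (i + 1) - p)) * Real.pi ^ (2 * (m - i)) =
        Real.pi * Real.pi ^ (2 * (N * (i + 1) - p + (m - i)) - 1) := by
      rw [← pow_add, ← pow_succ']
      congr 1
      omega
    push_cast
    linear_combination (-1) ^ (m - 1 - i) * (q (N * (i + 1) - p) * q (m - i) : ℝ) * this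
  rw [hsum, (hq (N * m + p + 1) (by omega)).2, (hq (m + 1) (by omega)).2] at hmain
  -- For N = 1 every monomial has degree 2m+1, so cancellation has to be excluded by positivity. For
  -- N > 1 the exponent 2Nm+2p+1 occurs once, with nonzero coefficient.
  by_cases hN1 : N = 1
  · have hp0 : p = 0 := by omega
    subst hN1
    subst hp0
    have hexp : ∀ i ∈ Finset.range m, 2 * (1 * (i + 1) - 0 + (m - i)) - 1 = 2 * m + 1 := by
      intro i hi
      have := Finset.mem_range.1 hi
      omega
    rw [Finset.sum_congr rfl fun i hi => by rw [hexp i hi], ← Finset.sum_mul] at hmain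
    let c : ℚ := 2 * q (1 * m + 0 + 1) - (-1) ^ m * (2 * q (m + 1)) +
      4 * ∑ i ∈ Finset.range m, (-1) ^ (m - 1 - i) * (q (1 * (i + 1) - 0) * q (m - i))
    have hc : lambertCombination 1 m = c * Real.pi ^ (2 * m + 1) := by
      refine mul_left_cancel₀ hpi ?_
      rw [hmain]
      push_cast [c]
      simp only [pow_zero, one_mul, inv_one, mul_one, add_zero]
      ring
    have hpos := lambertCombination_one_pos (hNm rfl)
    have hc0 : c ≠ 0 := by
      rintro h0
      rw [hc, h0] at hpos
      simp at hpos
    refine ⟨C c * X ^ (2 * m + 1), ?_, ?_⟩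
    · rw [natDegree_C_mul_X_pow _ _ hc0]
      omega
    · rw [hc]
      simp
  · have hexp : ∀ i ∈ Finset.range m,
        2 * (N * (i + 1) - p + (m - i)) - 1 ≠ 2 * N * m + 2 * p + 1 := by
      intro i hi
      have hi' := Finset.mem_range.1 hi
      have hl := hlow i
      obtain ⟨d, hd⟩ : ∃ d, m = i + 1 + d := ⟨m - (i + 1), by omega⟩
      have h1 : N * m = N * (i + 1) + N * d := by rw [hd, mul_add]
      have h2 : d ≤ N * d := Nat.le_mul_of_pos_left d (by omega)
      rw [mul_assoc]
      omega
    let P : ℚ[X] := C (2 * q (N * m + p + 1)) * X ^ (2 * N * m + 2 * p + 1) +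
      ∑ i ∈ Finset.range m, C (4 * ((-1) ^ (m - 1 - i) * (q (N * (i + 1) - p) * q (m - i)))) *
        X ^ (2 * (N * (i + 1) - p + (m - i)) - 1)
    have hcoeff : P.coeff (2 * N * m + 2 * p + 1) = 2 * q (N * m + p + 1) := by
      rw [coeff_add, coeff_C_mul_X_pow, if_pos rfl, finsetSum_coeff, Finset.sum_eq_zero, add_zero]
      intro i hi
      rw [coeff_C_mul_X_pow, if_neg (hexp i hi).symm]
    refine ⟨P, ?_, ?_⟩
    · refine le_trans ?_ (le_natDegree_of_ne_zero (n := 2 * N * m + 2 * p + 1) ?_)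
      · have : m ≤ N * m := Nat.le_mul_of_pos_left m (by omega)
        rw [mul_assoc]
        omega
      · rw [hcoeff]
        exact mul_ne_zero two_ne_zero (hq (N * m + p + 1) (by omega)).1
    · have hval : lambertCombination N m = 2 * q (N * m + p + 1) *
          Real.pi ^ (2 * N * m + 2 * p + 1) + ∑ i ∈ Finset.range m,
          4 * ((((-1) ^ (m - 1 - i) * (q (N * (i + 1) - p) * q (m - i)) : ℚ) : ℝ)
          * Real.pi ^ (2 * (N * (i + 1) - p + (m - i)) - 1)) := by
        refine mul_left_cancel₀ hpi ?_
        rw [hmain, if_neg hN1, ← Finset.mul_sum, show 2 * (N * m + p + 1) =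
          2 * N * m + 2 * p + 1 + 1 by ring, pow_succ _ (2 * N * m + 2 * p + 1)]
        ring
      rw [hval]
      simp only [P, map_add, map_sum, map_mul, map_pow, aeval_X, aeval_C]
      push_cast
      congr 1
      simp
      exact Finset.sum_congr rfl fun i _ => by ring

/-! ### From spans to infinitely many transcendental numbers. -/

open Polynomial in
/-- A set whose rational span contains polynomials in a transcendental number of arbitrarily large
degree contains infinitely many transcendental numbers. -/
theorem infinite_transcendental_of_span {S : Set ℂ} {τ : ℂ} (hτ : Transcendental ℚ τ)
    (h : ∀ d : ℕ, ∃ P : ℚ[X], d ≤ P.natDegree ∧ aeval τ P ∈ Submodule.span ℚ S) :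
    {x : ℂ | x ∈ S ∧ Transcendental ℚ x}.Infinite := by
  intro hfin
  let A := algebraicClosure ℚ ℂ
  have hAalg : Algebra.IsAlgebraic ℚ A := algebraicClosure.isAlgebraic ℚ ℂ
  have hτA : Transcendental A τ := hτ.extendScalars A
  -- Over the field A of algebraic numbers, every algebraic member of S is a multiple of 1, so V
  -- contains all of S.
  let V : Submodule A ℂ := Submodule.span A (insert 1 {x : ℂ | x ∈ S ∧ Transcendental ℚ x})
  have hVfin : FiniteDimensional A V := FiniteDimensional.span_of_finite A (hfin.insert 1)
  have hSV : Submodule.span ℚ S ≤ V.restrictScalars ℚ := by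
    refine Submodule.span_le.2 fun x hx => ?_
    by_cases hxt : Transcendental ℚ x
    · exact Submodule.subset_span (Set.mem_insert_of_mem _ ⟨hx, hxt⟩)
    · have hxA : x ∈ algebraicClosure ℚ ℂ := mem_algebraicClosure_iff.2 (not_not.1 hxt)
      have h1 : (1 : ℂ) ∈ V := Submodule.subset_span (Set.mem_insert _ _)
      have h2 := V.smul_mem (⟨x, hxA⟩ : A) h1
      change x * 1 ∈ V at h2
      rwa [mul_one] at h2
  let W : Submodule A A[X] := V.comap (aeval τ).toLinearMap
  have hinj : Function.Injective (aeval τ : A[X] →ₐ[A] ℂ) :=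
    transcendental_iff_injective.1 hτA
  have hWfin : FiniteDimensional A W := by
    let g : W →ₗ[A] V := (aeval τ).toLinearMap.restrict fun x hx => hx
    refine FiniteDimensional.of_injective g fun x y hxy => ?_
    exact Subtype.ext (hinj (congrArg Subtype.val hxy))
  -- Evaluation at τ is injective on A[X], so W is finite-dimensional and its degrees are bounded by
  -- those of finitely many generators.
  obtain ⟨F, hF⟩ := (Submodule.fg_iff_finiteDimensional W).2 hWfin
  have hbound : W ≤ degreeLE A (F.sup natDegree : ℕ) := by
    rw [← hF]
    refine Submodule.span_le.2 fun f hf => ?_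
    refine mem_degreeLE.2 (degree_le_of_natDegree_le ?_)
    exact Finset.le_sup (f := natDegree) hf
  obtain ⟨P, hPd, hP⟩ := h (F.sup natDegree + 1)
  have hPW : P.map (algebraMap ℚ A) ∈ W := by
    change aeval τ (P.map (algebraMap ℚ A)) ∈ V
    rw [aeval_map_algebraMap]
    exact hSV hP
  have h3 := natDegree_le_of_degree_le (mem_degreeLE.1 (hbound hPW))
  rw [natDegree_map] at h3
  omega

theorem evenSum_mem_of_riemannZeta_mem {s : ℕ} (hs : 2 ≤ s) {W : Submodule ℚ ℂ}
    (h : riemannZeta s ∈ W) : (evenSum s : ℂ) ∈ W := by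
  rw [riemannZeta_eq_evenSum hs] at h
  have := W.smul_mem ((2 ^ s)⁻¹ : ℚ) h
  rw [Rat.smul_def] at this
  push_cast at this
  rwa [inv_mul_cancel_left₀ (pow_ne_zero _ two_ne_zero)] at this

theorem mainTheorem8 (N : ℕ) (hN : Odd N) :
    ((∀ k : ℕ,
        Summable (fun n : ℕ => lambertTerm N (2 * N * (2 * k + 1) + 1) (n + 1)) ∧
        ∀ j : ℕ, j ≤ (N - 1) / 2 →
          Summable (fun n : ℕ => rotatedTerm N (4 * k + 3) j (n + 1))) ∧
      {x : ℂ | x ∈ (⋃ k : ℕ,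
          (({riemannZeta (4 * (k : ℂ) + 3),
              ((lambertSeries N (2 * N * (2 * k + 1) + 1) : ℝ) : ℂ)} : Set ℂ) ∪
            {z : ℂ | ∃ j : ℕ, j ≤ (N - 1) / 2 ∧
              z = ((rotatedSeries N (4 * k + 3) j : ℝ) : ℂ)})) ∧
        Transcendental ℚ x}.Infinite) ∧
    (1 < N →
      (∀ k : ℕ, 1 ≤ k →
        Summable (fun n : ℕ => lambertTerm N (4 * N * k + 1) (n + 1)) ∧
        ∀ j : ℕ, j ≤ (N - 1) / 2 →
          Summable (fun n : ℕ => rotatedTerm N (4 * k + 1) j (n + 1))) ∧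
      {x : ℂ | x ∈ (⋃ (k : ℕ) (_ : 1 ≤ k),
          (({riemannZeta (4 * (k : ℂ) + 1),
              ((lambertSeries N (4 * N * k + 1) : ℝ) : ℂ)} : Set ℂ) ∪
            {z : ℂ | ∃ j : ℕ, j ≤ (N - 1) / 2 ∧
              z = ((rotatedSeries N (4 * k + 1) j : ℝ) : ℂ)})) ∧
        Transcendental ℚ x}.Infinite) := by
  have hNpos := hN.pos
  refine ⟨⟨fun k => ⟨summable_lambertTerm N ?_, fun j hj => summable_rotatedTerm hN (by omega)
    (by omega)⟩, infinite_transcendental_of_span transcendental_pi fun d => ?_⟩,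
    fun hN1 => ⟨fun k hk => ⟨summable_lambertTerm N ?_, fun j hj => summable_rotatedTerm hN
      (by omega) (by omega)⟩, infinite_transcendental_of_span transcendental_pi fun d => ?_⟩⟩
  · have : 0 < 2 * N * (2 * k + 1) := by positivity
    omega
  · obtain ⟨P, hPd, hP⟩ := exists_polynomial_lambertCombination (m := 2 * d + 1) hN (by omega)
      fun _ => ⟨d, rfl⟩
    refine ⟨P, by omega, hP ▸ lambertCombination_mem hN (by omega) _ ?_ ?_ ?_ ?_⟩
    · obtain ⟨p, hp⟩ := hN
      -- The index solves 4k+3 = 2N(2d+1)+1 with N = 2p+1.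
      refine evenSum_mem_of_riemannZeta_mem ?_ (Submodule.subset_span (Set.mem_iUnion.2
        ⟨2 * p * d + p + d, Or.inl (Or.inl ?_)⟩))
      · have : 0 < 2 * N * (2 * d + 1) := by positivity
        omega
      · congr 1
        rw [hp]
        push_cast
        ring
    · exact Submodule.subset_span (Set.mem_iUnion.2 ⟨d, Or.inl (Or.inr rfl)⟩)
    · refine evenSum_mem_of_riemannZeta_mem (by omega) (Submodule.subset_span (Set.mem_iUnion.2
        ⟨d, Or.inl (Or.inl ?_)⟩))
      congr 1
      push_cast
      ring
    · intro j hj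
      refine Submodule.subset_span (Set.mem_iUnion.2 ⟨d, Or.inr ⟨j, hj, ?_⟩⟩)
      rw [show 2 * (2 * d + 1) + 1 = 4 * d + 3 by ring]
  · have : 0 < 4 * N * k := by positivity
    omega
  · obtain ⟨P, hPd, hP⟩ := exists_polynomial_lambertCombination (m := 2 * (d + 1)) hN (by omega)
      fun h => absurd h hN1.ne'
    refine ⟨P, by omega, hP ▸ lambertCombination_mem hN (by omega) _ ?_ ?_ ?_ ?_⟩
    · refine evenSum_mem_of_riemannZeta_mem ?_ (Submodule.subset_span (Set.mem_iUnion₂.2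
        ⟨N * (d + 1), Nat.mul_pos hNpos d.succ_pos, Or.inl (Or.inl ?_)⟩))
      · have : 0 < 2 * N * (2 * (d + 1)) := by positivity
        omega
      · congr 1
        push_cast
        ring
    · refine Submodule.subset_span (Set.mem_iUnion₂.2 ⟨d + 1, by omega, Or.inl (Or.inr ?_)⟩)
      rw [show 2 * N * (2 * (d + 1)) + 1 = 4 * N * (d + 1) + 1 by ring]
      rfl
    · refine evenSum_mem_of_riemannZeta_mem (by omega) (Submodule.subset_span (Set.mem_iUnion₂.2
        ⟨d + 1, by omega, Or.inl (Or.inl ?_)⟩))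
      congr 1
      push_cast
      ring
    · intro j hj
      refine Submodule.subset_span (Set.mem_iUnion₂.2 ⟨d + 1, by omega, Or.inr ⟨j, hj, ?_⟩⟩)
      rw [show 2 * (2 * (d + 1)) + 1 = 4 * (d + 1) + 1 by ring]
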